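/- Let $n\ge 2$, let $F_n$ be the free group of rank $n$, and let $R$ be a commutative ring with unit for which the natural map $\mathbb Z\to R$ is injective. Put $H_{\mathbb Z}=F_n^{\mathrm{ab}}$ and $H=H_1(F_n;R)=F_n^{\mathrm{ab}}\otimes_{\mathbb Z}R$, write $[\gamma]\in H$ for the class of $\gamma\in F_n$, and let $\otimes$, $\mathrm{Hom}$ and $H^*=\mathrm{Hom}(H,R)$ be taken over $R$. Let $\widehat T=\prod_{m\ge 0}H^{\otimes m}$ be the completed tensor algebra, with the ideals $\widehat T_p=\prod_{m\ge p}H^{\otimes m}$. Let $IA(\widehat T)$ be the group of $R$-algebra automorphisms $U$ of $\widehat T$ with $U(\widehat T_p)=\widehat T_p$ for all $p\ge 1$ that induce the identity on $\widehat T_1/\widehat T_2=H$. A *Magnus expansion* is a group homomorphism $\theta:F_n\to 1+\widehat T_1$ with $\theta(\gamma)\equiv 1+[\gamma] \pmod{\widehat T_2}$ for all $\gamma\in F_n$; write $\theta_m(\gamma)\in H^{\otimes m}$ for the degree $m$ component of $\theta(\gamma)$. For $\varphi\in\mathrm{Aut}(F_n)$ let $|\varphi|\in GL(H)$ be the induced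 map, extended to $\widehat T$ by $|\varphi|^{\otimes m}$ on $H^{\otimes m}$. Let $\Gamma_1=F_n$, $\Gamma_{m+1}=[\Gamma_m,F_n]$, and $A(m)=\mathrm{Ker}(\mathrm{Aut}(F_n)\to \mathrm{Aut}(\Gamma_1/\Gamma_{m+1}))$. For a Magnus expansion $\theta^0$, the map $\theta^0_{m}$ induces a homomorphism from $\Gamma_m/\Gamma_{m+1}$ onto a subgroup $\mathcal L_m\subset H^{\otimes m}$, through which $\Gamma_m/\Gamma_{m+1}$ is identified with $\mathcal L_m$. The (classical) $m$-th Johnson homomorphism $\tau_m$ sends $\varphi\in A(m)$ to the element $[\gamma]\mapsto \gamma^{-1}\varphi(\gamma) \bmod \Gamma_{m+2}$ of $\mathrm{Hom}_{\mathbb Z}(H_{\mathbb Z},\Gamma_{m+1}/\Gamma_{m+2})=\mathrm{Hom}_{\mathbb Z}(H_{\mathbb Z},\mathcal L_{m+1})$, which is regarded by extension of scalars as a subgroup of $\mathrm{Hom}(H,H^{\otimes(m+1)})=H^*\otimes H^{\otimes(m+1)}$. **Theorem 3.1.** (i) For every Magnus expansion $\theta$ and every $\varphi\in\mathrm{Aut}(F_n)$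 there is a unique $\tau^\theta(\varphi)\in IA(\widehat T)$ with $$|\varphi|\circ\theta\circ\varphi^{-1}=\tau^\theta(\varphi)^{-1}\circ\theta .$$ Hence the *$m$-th Johnson map* $\tau^\theta_m:\mathrm{Aut}(F_n)\to \mathrm{Hom}(H,H^{\otimes(m+1)})=H^*\otimes H^{\otimes (m+1)}$ is defined, where $\tau^\theta_m(\varphi)$ is the component of $\tau^\theta(\varphi)|_H-1_H$ in degree $m+1$. (ii) For every $m\ge 1$ and every Magnus expansion $\theta$, $$\tau_m=\tau^\theta_m|_{A(m)}:A(m)\to H^*\otimes H^{\otimes(m+1)},$$ whichever Magnus expansion $\theta^0$ is used to identify $\Gamma_{m+1}/\Gamma_{m+2}$ with $\mathcal L_{m+1}$. In particular $\tau^\theta_m|_{A(m)}$ is a group homomorphism and is independent of $\theta$. -/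

import Mathlib

open scoped TensorProduct commutatorElement

noncomputable section

namespace JohnsonMaps

/-! ### The completed tensor algebra -/

section TensorAlgebra

variable (R : Type*) [CommRing R] (M : Type*) [AddCommGroup M] [Module R M]

/-- `M^{⊗m}`, realised as the homogeneous component of degree `m` of the tensor algebra of `M`. -/
abbrev tensorPow (m : ℕ) : Submodule R (TensorAlgebra R M) :=
  LinearMap.range (TensorAlgebra.ι R (M := M)) ^ m

/-- The completed tensor algebra `∏_m M^{⊗m}` with the Cauchy product: a sequence `(z_m)` with
`z_m ∈ M^{⊗m}` is written as the formal power series `∑ z_m t^m` (the variable `t` is central and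
only records the degree). -/
def CompletedTensor : Subalgebra R (PowerSeries (TensorAlgebra R M)) where
  carrier := {f | ∀ m, PowerSeries.coeff m f ∈ tensorPow R M m}
  mul_mem' := by
    intro a b ha hb m
    rw [PowerSeries.coeff_mul]
    refine Submodule.sum_mem _ fun p hp => ?_
    rw [← Finset.HasAntidiagonal.mem_antidiagonal.mp hp, tensorPow, pow_add]
    exact Submodule.mul_mem_mul (ha _) (hb _)
  add_mem' := by
    intro a b ha hb m
    rw [map_add]
    exact Submodule.add_mem _ (ha m) (hb m)
  algebraMap_mem' := by
    intro r m
    rw [PowerSeries.algebraMap_apply]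
    cases m with
    | zero =>
      rw [PowerSeries.coeff_zero_C, tensorPow, pow_zero]
      exact Submodule.algebraMap_mem r
    | succ k =>
      rw [PowerSeries.coeff_succ_C]
      exact Submodule.zero_mem _

variable {M}

/-- The component `z ↦ z_m ∈ M^{⊗m}` of an element of the completed tensor algebra. -/
def comp (m : ℕ) : CompletedTensor R M →ₗ[R] tensorPow R M m where
  toFun z := ⟨PowerSeries.coeff m z.1, z.2 m⟩
  map_add' a b := Subtype.ext (map_add (PowerSeries.coeff m) a.1 b.1)
  map_smul' r a := Subtype.ext (by
    change PowerSeries.coeff m (r • a.1) = r • PowerSeries.coeff m a.1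
    rfl)

variable {R} in
theorem coe_comp (m : ℕ) (z : CompletedTensor R M) :
    (comp R m z : TensorAlgebra R M) = PowerSeries.coeff m z.1 :=
  rfl

theorem completedTensor_ext {a b : CompletedTensor R M} (h : ∀ m, comp R m a = comp R m b) :
    a = b :=
  Subtype.ext (PowerSeries.ext fun m => congrArg Subtype.val (h m))

variable {R} in
/-- The element `∑_m f_m` of the completed tensor algebra with given components `f_m`. -/
def ofSeq (f : ∀ m, tensorPow R M m) : CompletedTensor R M :=
  ⟨PowerSeries.mk fun m => (f m : TensorAlgebra R M), fun m =>
    (PowerSeries.coeff_mk m fun m => (f m : TensorAlgebra R M)).symm ▸ (f m).2⟩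

variable {R} in
theorem comp_ofSeq (f : ∀ m, tensorPow R M m) (m : ℕ) : comp R m (ofSeq f) = f m :=
  Subtype.ext (PowerSeries.coeff_mk m fun m => (f m : TensorAlgebra R M))

variable {R} in
theorem ite_mem_tensorPow (x : M) (m : ℕ) :
    (if m = 1 then TensorAlgebra.ι R x else 0) ∈ tensorPow R M m := by
  split_ifs with h
  · subst h
    rw [tensorPow, pow_one]
    exact LinearMap.mem_range_self _ x
  · exact Submodule.zero_mem _

/-- The inclusion of `M = M^{⊗1}` in the completed tensor algebra. -/
def incl : M →ₗ[R] CompletedTensor R M where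
  toFun x := ofSeq fun m => ⟨if m = 1 then TensorAlgebra.ι R x else 0, ite_mem_tensorPow x m⟩
  map_add' x y := completedTensor_ext R fun m => Subtype.ext (by
    rw [map_add (comp R m), comp_ofSeq, comp_ofSeq, comp_ofSeq, Submodule.coe_add]
    split_ifs <;> simp)
  map_smul' r x := completedTensor_ext R fun m => Subtype.ext (by
    rw [map_smul (comp R m), comp_ofSeq, comp_ofSeq, Submodule.coe_smul]
    split_ifs <;> simp)

variable {R} in
theorem coe_comp_incl (m : ℕ) (x : M) :
    (comp R m (incl R x) : TensorAlgebra R M) = if m = 1 then TensorAlgebra.ι R x else 0 :=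
  congrArg Subtype.val (comp_ofSeq _ m)

variable (M) in
/-- The two-sided ideal `∏_{m ≥ p} M^{⊗m}`, as a submodule of the completed tensor algebra. -/
def filt (p : ℕ) : Submodule R (CompletedTensor R M) where
  carrier := {z | ∀ m < p, comp R m z = 0}
  add_mem' := by
    intro a b ha hb m hm
    rw [map_add, ha m hm, hb m hm, add_zero]
  zero_mem' := fun m _ => map_zero _
  smul_mem' := by
    intro r a ha m hm
    rw [map_smul, ha m hm, smul_zero]

variable {R} in
theorem filt_anti {p q : ℕ} (h : p ≤ q) : filt R M q ≤ filt R M p :=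
  fun _ hz m hm => hz m (hm.trans_le h)

variable {R} in
theorem mul_mem_filt {p q : ℕ} {a b : CompletedTensor R M} (ha : a ∈ filt R M p)
    (hb : b ∈ filt R M q) : a * b ∈ filt R M (p + q) := by
  intro m hm
  refine Subtype.ext ?_
  change PowerSeries.coeff m (a.1 * b.1) = 0
  rw [PowerSeries.coeff_mul]
  refine Finset.sum_eq_zero fun x hx => ?_
  have hx' := Finset.HasAntidiagonal.mem_antidiagonal.mp hx
  rcases lt_or_ge x.1 p with h | h
  · have h0 : PowerSeries.coeff x.1 a.1 = 0 := congrArg Subtype.val (ha _ h)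
    rw [h0, zero_mul]
  · have h0 : PowerSeries.coeff x.2 b.1 = 0 := congrArg Subtype.val (hb x.2 (by omega))
    rw [h0, mul_zero]

variable {R} in
theorem mem_filt_zero (a : CompletedTensor R M) : a ∈ filt R M 0 :=
  fun _ hm => absurd hm (Nat.not_lt_zero _)

variable {R} in
/-- The algebra endomorphism of the tensor algebra induced by a linear endomorphism `A` of `M`. -/
def mapTensor (A : M →ₗ[R] M) : TensorAlgebra R M →ₐ[R] TensorAlgebra R M :=
  TensorAlgebra.lift R (TensorAlgebra.ι R ∘ₗ A)

variable {R} in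
theorem mapTensor_ι (A : M →ₗ[R] M) (x : M) :
    mapTensor A (TensorAlgebra.ι R x) = TensorAlgebra.ι R (A x) := by
  rw [mapTensor, TensorAlgebra.lift_ι_apply, LinearMap.comp_apply]

/-- The endomorphism `z_m ↦ A^{⊗m} z_m` of the completed tensor algebra induced by a linear
endomorphism `A` of `M`. -/
def mapCompleted (A : M →ₗ[R] M) : CompletedTensor R M →ₐ[R] CompletedTensor R M :=
  ((PowerSeries.mapAlgHom (mapTensor A)).comp (CompletedTensor R M).val).codRestrict
    (CompletedTensor R M) (by
      intro z m
      have h : LinearMap.range (TensorAlgebra.ι R (M := M)) ≤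
          (LinearMap.range (TensorAlgebra.ι R (M := M))).comap
            (mapTensor A).toLinearMap := by
        rintro _ ⟨x, rfl⟩
        exact ⟨A x, (mapTensor_ι A x).symm⟩
      have h2 : (tensorPow R M m).map (mapTensor A).toLinearMap ≤ tensorPow R M m := by
        rw [tensorPow, Submodule.map_pow]
        exact pow_le_pow_left' (Submodule.map_le_iff_le_comap.mpr h) m
      have h3 : PowerSeries.coeff m (((PowerSeries.mapAlgHom (mapTensor A)).comp
          (CompletedTensor R M).val) z) = mapTensor A (PowerSeries.coeff m z.1) := by
        simp [PowerSeries.mapAlgHom_apply]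
      rw [h3]
      exact h2 ⟨_, z.2 m, rfl⟩)

theorem comp_mapCompleted (A : M →ₗ[R] M) (m : ℕ) (z : CompletedTensor R M) :
    (comp R m (mapCompleted R A z) : TensorAlgebra R M) = mapTensor A (comp R m z) := by
  change PowerSeries.coeff m (PowerSeries.mapAlgHom (mapTensor A) z.1) = _
  rw [PowerSeries.mapAlgHom_apply, PowerSeries.coeff_map]
  rfl

variable (M) in
/-- The group of filtration-preserving `R`-algebra automorphisms of the completed tensor algebra
(those with `U (filt p) = filt p` for all `p ≥ 1`) that induce the identity on
`filt 1 / filt 2 = M`. -/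
def IA : Subgroup (CompletedTensor R M ≃ₐ[R] CompletedTensor R M) where
  carrier := {U | (∀ p, 1 ≤ p → (filt R M p).map U.toLinearMap = filt R M p) ∧
    ∀ z ∈ filt R M 1, U z - z ∈ filt R M 2}
  mul_mem' := by
    rintro U V ⟨hU, hU'⟩ ⟨hV, hV'⟩
    refine ⟨fun p hp => ?_, fun z hz => ?_⟩
    · have : (U * V).toLinearMap = U.toLinearMap ∘ₗ V.toLinearMap := rfl
      rw [this, Submodule.map_comp, hV p hp, hU p hp]
    · have h1 : V z ∈ filt R M 1 := by
        rw [← hV 1 le_rfl]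
        exact ⟨z, hz, rfl⟩
      have := Submodule.add_mem _ (hU' _ h1) (hV' z hz)
      simpa using this
  one_mem' := by
    refine ⟨fun p _ => ?_, fun z _ => ?_⟩
    · have : (1 : CompletedTensor R M ≃ₐ[R] CompletedTensor R M).toLinearMap = LinearMap.id := rfl
      rw [this, Submodule.map_id]
    · simp
  inv_mem' := by
    rintro U ⟨hU, hU'⟩
    have key : ∀ p, 1 ≤ p → ∀ z ∈ filt R M p, U⁻¹ z ∈ filt R M p := by
      intro p hp z hz
      rw [← hU p hp] at hz
      obtain ⟨w, hw, rfl⟩ := hz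
      have : U⁻¹ (U w) = w := U.symm_apply_apply w
      exact this.symm ▸ hw
    refine ⟨fun p hp => le_antisymm ?_ ?_, fun z hz => ?_⟩
    · rintro _ ⟨z, hz, rfl⟩
      exact key p hp z hz
    · intro z hz
      refine ⟨U z, ?_, U.symm_apply_apply z⟩
      change U z ∈ filt R M p
      rw [← hU p hp]
      exact ⟨z, hz, rfl⟩
    · have h := Submodule.neg_mem _ (hU' _ (key 1 le_rfl z hz))
      have e : U (U⁻¹ z) = z := U.apply_symm_apply z
      rwa [e, neg_sub] at h

/-- `E U = U|_M - 1_M`, a linear map from `M` to the completed tensor algebra; for `U` in `IA` it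
takes its values in `filt 2`. -/
def E (U : CompletedTensor R M ≃ₐ[R] CompletedTensor R M) : M →ₗ[R] CompletedTensor R M :=
  U.toLinearMap ∘ₗ incl R - incl R

end TensorAlgebra

/-! ### The free group, its homology and its lower central series -/

/-- The integral first homology group (the abelianization) of the free group of rank `n`,
written additively. -/
abbrev HZ (n : ℕ) : Type := Additive (Abelianization (FreeGroup (Fin n)))

/-- The first homology group of the free group of rank `n` with coefficients in `R`. -/
abbrev H (R : Type*) [CommRing R] (n : ℕ) : Type _ := R ⊗[ℤ] HZ n

/-- The class `[γ]` in the first homology group with coefficients in `R`. -/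
def cls (R : Type*) [CommRing R] {n : ℕ} (γ : FreeGroup (Fin n)) : H R n :=
  (1 : R) ⊗ₜ[ℤ] Additive.ofMul (Abelianization.of γ)

/-- The automorphism `|φ|` of the first homology group induced by an automorphism `φ` of the
free group. -/
def absMap (R : Type*) [CommRing R] {n : ℕ} (φ : MulAut (FreeGroup (Fin n))) :
    H R n →ₗ[R] H R n :=
  LinearMap.baseChange R
    (MonoidHom.toAdditive (Abelianization.map φ.toMonoidHom)).toIntLinearMap

theorem absMap_cls (R : Type*) [CommRing R] {n : ℕ} (φ : MulAut (FreeGroup (Fin n)))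
    (γ : FreeGroup (Fin n)) : absMap R φ (cls R γ) = cls R (φ γ) := by
  rw [absMap, cls, LinearMap.baseChange_tmul]
  rfl

theorem cls_mul (R : Type*) [CommRing R] {n : ℕ} (γ δ : FreeGroup (Fin n)) :
    cls R (γ * δ) = cls R γ + cls R δ := by
  rw [cls, map_mul, ofMul_mul, TensorProduct.tmul_add]
  rfl

/-- The term `Γ_{m+1}` of the lower central series `Γ_1 = F_n`, `Γ_{m+1} = [Γ_m, F_n]`.
Beware of the shift: `Gam n m` is `Γ_{m+1}`. -/
abbrev Gam (n m : ℕ) : Subgroup (FreeGroup (Fin n)) :=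
  (⊤ : Subgroup (FreeGroup (Fin n))).lowerCentralSeries m

/-- The Andreadakis filtration: `A(m)` is the group of those automorphisms of the free group that
act trivially on `Γ_1 / Γ_{m+1}`. -/
def Andreadakis (n m : ℕ) : Subgroup (MulAut (FreeGroup (Fin n))) where
  carrier := {φ | ∀ γ : FreeGroup (Fin n),
    (QuotientGroup.mk (φ γ) : FreeGroup (Fin n) ⧸ Gam n m) = QuotientGroup.mk γ}
  mul_mem' := by
    intro φ ψ hφ hψ γ
    exact (hφ (ψ γ)).trans (hψ γ)
  one_mem' := fun _ => rfl
  inv_mem' := by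
    intro φ hφ γ
    have h := hφ (φ⁻¹ γ)
    rw [MulAut.apply_inv_self] at h
    exact h.symm

/-! ### Magnus expansions -/

/-- An `R`-valued Magnus expansion of the free group of rank `n`: a multiplicative map `θ` with
`θ(γ) ≡ 1 + [γ]` modulo `filt 2`. (So `θ` takes its values in the group `1 + filt 1`.) -/
structure MagnusExpansion (R : Type*) [CommRing R] (n : ℕ) where
  /-- the underlying multiplicative map -/
  toHom : FreeGroup (Fin n) →* CompletedTensor R (H R n)
  congr_one_add : ∀ γ, toHom γ - (1 + incl R (cls R γ)) ∈ filt R (H R n) 2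

section Magnus

variable {R : Type*} [CommRing R] {n : ℕ}

theorem comp_zero_incl (x : H R n) : comp R 0 (incl R x) = 0 := by
  refine Subtype.ext ?_
  rw [coe_comp_incl, if_neg zero_ne_one]
  rfl

theorem incl_mem_filt (x : H R n) : incl R x ∈ filt R (H R n) 1 := by
  intro m hm
  obtain rfl : m = 0 := by omega
  exact comp_zero_incl x

namespace MagnusExpansion

/-- The Magnus expansion `φ · θ = |φ| ∘ θ ∘ φ⁻¹`. -/
def act (φ : MulAut (FreeGroup (Fin n))) (θ : MagnusExpansion R n) : MagnusExpansion R n where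
  toHom := ((mapCompleted R (absMap R φ)).toRingHom.toMonoidHom.comp θ.toHom).comp
    (φ⁻¹ : MulAut (FreeGroup (Fin n))).toMonoidHom
  congr_one_add := by
    intro γ
    have h := θ.congr_one_add (φ⁻¹ γ)
    have e : mapCompleted R (absMap R φ) (incl R (cls R (φ⁻¹ γ))) = incl R (cls R γ) := by
      refine completedTensor_ext R fun m => Subtype.ext ?_
      rw [comp_mapCompleted, coe_comp_incl, coe_comp_incl]
      split_ifs
      · rw [mapTensor_ι, absMap_cls, MulAut.apply_inv_self]
      · exact map_zero _
    have e2 : mapCompleted R (absMap R φ) (θ.toHom (φ⁻¹ γ)) - (1 + incl R (cls R γ)) =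
        mapCompleted R (absMap R φ) (θ.toHom (φ⁻¹ γ) - (1 + incl R (cls R (φ⁻¹ γ)))) := by
      rw [map_sub, map_add, map_one, e]
    change mapCompleted R (absMap R φ) (θ.toHom (φ⁻¹ γ)) - (1 + incl R (cls R γ)) ∈ _
    rw [e2]
    intro m hm
    refine Subtype.ext ?_
    rw [comp_mapCompleted, h m hm]
    exact map_zero _

/-- The total Johnson map `τ^θ`: `τ^θ(φ)` is the unique element of `IA` with
`φ · θ = τ^θ(φ)⁻¹ ∘ θ`. (If there were no such element, the value would be `1`.) -/
def totalJohnson (θ : MagnusExpansion R n) (φ : MulAut (FreeGroup (Fin n))) :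
    CompletedTensor R (H R n) ≃ₐ[R] CompletedTensor R (H R n) :=
  open Classical in
  if h : ∃ U ∈ IA R (H R n), ∀ γ, (θ.act φ).toHom γ = U⁻¹ (θ.toHom γ) then h.choose else 1

/-- The `m`-th Johnson map `τ^θ_m`, with values in
`Hom(H, H^{⊗(m+1)}) = H^* ⊗ H^{⊗(m+1)}`: the component of degree `m + 1` of `E (τ^θ(φ))`. -/
def johnsonMap (θ : MagnusExpansion R n) (m : ℕ) (φ : MulAut (FreeGroup (Fin n))) :
    H R n →ₗ[R] tensorPow R (H R n) (m + 1) :=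
  comp R (m + 1) ∘ₗ E R (θ.totalJohnson φ)

theorem sub_one_mem (θ : MagnusExpansion R n) (γ : FreeGroup (Fin n)) :
    θ.toHom γ - 1 ∈ filt R (H R n) 1 := by
  have h := Submodule.add_mem _ (filt_anti one_le_two (θ.congr_one_add γ))
    (incl_mem_filt (cls R γ))
  have e : θ.toHom γ - (1 + incl R (cls R γ)) + incl R (cls R γ) = θ.toHom γ - 1 := by abel
  rwa [e] at h

theorem sub_one_mem_of_mem_Gam (θ : MagnusExpansion R n) (m : ℕ) :
    ∀ γ ∈ Gam n m, θ.toHom γ - 1 ∈ filt R (H R n) (m + 1) := by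
  induction m with
  | zero => exact fun γ _ => θ.sub_one_mem γ
  | succ m ih =>
    intro γ hγ
    let D : Subgroup (FreeGroup (Fin n)) :=
      { carrier := {γ | θ.toHom γ - 1 ∈ filt R (H R n) (m + 1 + 1)}
        one_mem' := by
          change θ.toHom 1 - 1 ∈ filt R (H R n) (m + 1 + 1)
          rw [map_one, sub_self]
          exact Submodule.zero_mem _
        mul_mem' := by
          intro a b ha hb
          have e : θ.toHom (a * b) - 1 =
              θ.toHom a * (θ.toHom b - 1) + (θ.toHom a - 1) := by
            rw [map_mul, mul_sub, mul_one]; abel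
          change θ.toHom (a * b) - 1 ∈ filt R (H R n) (m + 1 + 1)
          rw [e]
          have h := mul_mem_filt (mem_filt_zero (θ.toHom a)) hb
          rw [zero_add] at h
          exact Submodule.add_mem _ h ha
        inv_mem' := by
          intro a ha
          have e : θ.toHom a⁻¹ - 1 = -(θ.toHom a⁻¹ * (θ.toHom a - 1)) := by
            rw [mul_sub, ← map_mul, inv_mul_cancel, map_one, mul_one, neg_sub]
          change θ.toHom a⁻¹ - 1 ∈ filt R (H R n) (m + 1 + 1)
          rw [e]
          have h := mul_mem_filt (mem_filt_zero (θ.toHom a⁻¹)) ha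
          rw [zero_add] at h
          exact Submodule.neg_mem _ h }
    have hD : Gam n (m + 1) ≤ D := by
      refine Subgroup.commutator_le.mpr fun a ha b _ => ?_
      have e : θ.toHom ⁅a, b⁆ - 1 = ((θ.toHom a - 1) * (θ.toHom b - 1) -
          (θ.toHom b - 1) * (θ.toHom a - 1)) * θ.toHom (a⁻¹ * b⁻¹) := by
        have e1 : θ.toHom ⁅a, b⁆ = θ.toHom a * θ.toHom b * θ.toHom (a⁻¹ * b⁻¹) := by
          rw [← map_mul, ← map_mul, commutatorElement_def]
          congr 1
          group
        have e2 : θ.toHom b * θ.toHom a * θ.toHom (a⁻¹ * b⁻¹) = 1 := by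
          rw [← map_mul, ← map_mul, ← map_one θ.toHom]
          congr 1
          group
        have e3 : (θ.toHom a - 1) * (θ.toHom b - 1) - (θ.toHom b - 1) * (θ.toHom a - 1) =
            θ.toHom a * θ.toHom b - θ.toHom b * θ.toHom a := by
          simp only [sub_mul, mul_sub, one_mul, mul_one]
          abel
        rw [e3, sub_mul, e2, e1]
      change θ.toHom ⁅a, b⁆ - 1 ∈ filt R (H R n) (m + 1 + 1)
      rw [e]
      have h1 := mul_mem_filt (ih a ha) (θ.sub_one_mem b)
      have h2 := mul_mem_filt (θ.sub_one_mem b) (ih a ha)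
      rw [add_comm 1 (m + 1)] at h2
      have h := mul_mem_filt (Submodule.sub_mem _ h1 h2) (mem_filt_zero (θ.toHom (a⁻¹ * b⁻¹)))
      rwa [add_zero] at h
    exact hD hγ

/-- The restriction of `θ_{m+1}` to `Γ_{m+1}`, a group homomorphism to `H^{⊗(m+1)}`. -/
def grAux (θ : MagnusExpansion R n) (m : ℕ) :
    Gam n m →* Multiplicative (tensorPow R (H R n) (m + 1)) where
  toFun γ := Multiplicative.ofAdd (comp R (m + 1) (θ.toHom γ.1))
  map_one' := by
    refine congrArg Multiplicative.ofAdd (Subtype.ext ?_)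
    change PowerSeries.coeff (m + 1) (θ.toHom 1).1 = 0
    rw [map_one]
    change PowerSeries.coeff (m + 1) (1 : PowerSeries (TensorAlgebra R (H R n))) = 0
    rw [PowerSeries.coeff_one, if_neg (Nat.succ_ne_zero m)]
  map_mul' := by
    intro a b
    have h := filt_anti (by omega : m + 2 ≤ m + 1 + (m + 1)) (mul_mem_filt
      (θ.sub_one_mem_of_mem_Gam m a.1 a.2) (θ.sub_one_mem_of_mem_Gam m b.1 b.2))
    have h0 := h (m + 1) (by omega)
    have h1 : comp R (m + 1) (1 : CompletedTensor R (H R n)) = 0 := by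
      refine Subtype.ext ?_
      change PowerSeries.coeff (m + 1) (1 : PowerSeries (TensorAlgebra R (H R n))) = 0
      rw [PowerSeries.coeff_one, if_neg (Nat.succ_ne_zero m)]
    have e : θ.toHom (a * b : Gam n m).1 = (θ.toHom a.1 - 1) * (θ.toHom b.1 - 1) +
        θ.toHom a.1 + θ.toHom b.1 - 1 := by
      rw [Subgroup.coe_mul, map_mul]
      simp only [sub_mul, mul_sub, one_mul, mul_one]
      abel
    rw [← ofAdd_add, e, map_sub, map_add, map_add, h0, h1, zero_add, sub_zero]

/-- The homomorphism `Γ_{m+1} / Γ_{m+2} → H^{⊗(m+1)}` induced by `θ_{m+1}`. -/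
def gr (θ : MagnusExpansion R n) (m : ℕ) :
    Gam n m ⧸ (Gam n (m + 1)).subgroupOf (Gam n m) →*
      Multiplicative (tensorPow R (H R n) (m + 1)) :=
  QuotientGroup.lift _ (θ.grAux m) (by
    intro γ hγ
    exact congrArg Multiplicative.ofAdd (by
      have h := θ.sub_one_mem_of_mem_Gam (m + 1) γ.1 hγ (m + 1) (by omega)
      have h1 : comp R (m + 1) (1 : CompletedTensor R (H R n)) = 0 := by
        refine Subtype.ext ?_
        change PowerSeries.coeff (m + 1) (1 : PowerSeries (TensorAlgebra R (H R n))) = 0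
        rw [PowerSeries.coeff_one, if_neg (Nat.succ_ne_zero m)]
      rw [map_sub, h1, sub_zero] at h
      exact h))

/-- The subgroup `𝓛_{m+1} = θ_{m+1}(Γ_{m+1} / Γ_{m+2})` of `H^{⊗(m+1)}`. -/
def Lie (θ : MagnusExpansion R n) (m : ℕ) : AddSubgroup (tensorPow R (H R n) (m + 1)) :=
  AddMonoidHom.range (MonoidHom.toAdditiveLeft (θ.gr m))

/-- The map `Γ_{m+1} / Γ_{m+2} → 𝓛_{m+1}` induced by `θ_{m+1}`, through which the two groups are
identified. -/
def grLie (θ : MagnusExpansion R n) (m : ℕ) :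
    Gam n m ⧸ (Gam n (m + 1)).subgroupOf (Gam n m) →* Multiplicative (θ.Lie m) :=
  AddMonoidHom.toMultiplicativeRight (AddMonoidHom.rangeRestrict
    (MonoidHom.toAdditiveLeft (θ.gr m)))

end MagnusExpansion

/-! ### The classical Johnson homomorphisms -/

theorem inv_mul_mem_Gam {m : ℕ} (φ : Andreadakis n m) (γ : FreeGroup (Fin n)) :
    γ⁻¹ * φ.1 γ ∈ Gam n m :=
  QuotientGroup.eq.mp (φ.2 γ).symm

/-- For `φ ∈ A(m)`, the homomorphism `γ ↦ γ⁻¹ φ(γ) mod Γ_{m+2}` to `Γ_{m+1} / Γ_{m+2}`. -/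
def johnsonQuot {m : ℕ} (φ : Andreadakis n m) :
    FreeGroup (Fin n) →* Gam n m ⧸ (Gam n (m + 1)).subgroupOf (Gam n m) where
  toFun γ := QuotientGroup.mk ⟨γ⁻¹ * φ.1 γ, inv_mul_mem_Gam φ γ⟩
  map_one' := by
    refine congrArg QuotientGroup.mk (Subtype.ext ?_)
    change (1 : FreeGroup (Fin n))⁻¹ * φ.1 1 = 1
    rw [map_one, inv_one, one_mul]
  map_mul' := by
    intro γ δ
    rw [← QuotientGroup.mk_mul]
    refine QuotientGroup.eq.mpr (Subgroup.mem_subgroupOf.mpr ?_)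
    change ((γ * δ)⁻¹ * φ.1 (γ * δ))⁻¹ * ((γ⁻¹ * φ.1 γ) * (δ⁻¹ * φ.1 δ)) ∈ Gam n (m + 1)
    have hc := inv_mul_mem_Gam φ γ
    have hcomm : ⁅(γ⁻¹ * φ.1 γ)⁻¹, δ⁆ ∈ Gam n (m + 1) :=
      Subgroup.commutator_mem_commutator (Subgroup.inv_mem _ hc) (Subgroup.mem_top _)
    have hn2 := (inferInstance : (Gam n (m + 1)).Normal).conj_mem _ hcomm (φ.1 δ)⁻¹
    convert hn2 using 1
    rw [map_mul, commutatorElement_def]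
    group

/-- The `m`-th Johnson homomorphism `τ_m : A(m) → Hom_ℤ(H_ℤ, 𝓛_{m+1})`, which sends `φ` to
`[γ] ↦ γ⁻¹ φ(γ) mod Γ_{m+2}`; here `Γ_{m+1} / Γ_{m+2}` is identified with `𝓛_{m+1}` through the
Magnus expansion `θ₀`. -/
def johnsonHom (θ₀ : MagnusExpansion R n) (m : ℕ) (φ : Andreadakis n m) : HZ n →+ θ₀.Lie m :=
  MonoidHom.toAdditiveLeft (Abelianization.lift ((θ₀.grLie m).comp (johnsonQuot φ)))

/-- The map `Hom_ℤ(H_ℤ, 𝓛_{m+1}) → Hom_R(H, H^{⊗(m+1)}) = H^* ⊗ H^{⊗(m+1)}`, `f ↦ (r ⊗ a ↦ r f(a))`,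
by which the former group is regarded as a subgroup of the latter. -/
def extendScalars (θ₀ : MagnusExpansion R n) (m : ℕ) (f : HZ n →+ θ₀.Lie m) :
    H R n →ₗ[R] tensorPow R (H R n) (m + 1) :=
  LinearMap.liftBaseChange R (((θ₀.Lie m).subtype.comp f).toIntLinearMap)

end Magnus

end JohnsonMaps

end

noncomputable section

open scoped TensorProduct commutatorElement

namespace JohnsonMaps

/-! ### Continuous endomorphisms of the completed tensor algebra -/

section Endomorphisms

variable {R : Type*} [CommRing R] {M : Type*} [AddCommGroup M] [Module R M]

/-! The completed tensor algebra is separated and complete for `filt`, with the tensor algebra dense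
in it. Hence each linear map from `M` to `filt 1` extends to exactly one filtered algebra
endomorphism. If the map is the inclusion modulo `filt 2`, the extension is the identity on graded
pieces, hence bijective, and lies in `IA`.

`H R n` is free over `R` on the classes of the generators `x_i`. So for a Magnus expansion `θ` there
is `V` in `IA` with `V [x_i] = θ(x_i) - 1`; thus `V` carries the standard expansion `x_i ↦ 1 +
[x_i]` to `θ`. It follows that `IA` acts simply transitively on Magnus expansions. Applied to `θ`
and `θ.act φ`, this is (i).

For (ii), let `φ ∈ A(m)`, `U = τ^θ(φ)` and `c = γ⁻¹ φ(γ)`. Since `|φ| = 1`, `U θ(γ) = θ(φ γ) = θ(γ)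
θ(c)`, while `θ(c) - 1 ∈ filt (m+1)`. Comparison with `θ(γ) ≡ 1 + [γ]` shows, by raising the
precision one degree at a time, that `U [γ] - [γ] ≡ θ(c) - 1` modulo `filt (m+2)`. The component of
degree `m+1` is then `θ_{m+1}(c)`. It does not depend on `θ`, because elements of `IA` do not change
leading terms (`apply_sub_mem_filt`). -/

theorem mul_mem_filt_left {q : ℕ} (a : CompletedTensor R M) {b : CompletedTensor R M}
    (hb : b ∈ filt R M q) : a * b ∈ filt R M q := by
  have h := mul_mem_filt (mem_filt_zero a) hb
  rwa [zero_add] at h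

theorem mul_mem_filt_right {q : ℕ} {a : CompletedTensor R M} (ha : a ∈ filt R M q)
    (b : CompletedTensor R M) : a * b ∈ filt R M q := by
  have h := mul_mem_filt ha (mem_filt_zero b)
  rwa [add_zero] at h

theorem eq_zero_of_forall_mem_filt {z : CompletedTensor R M} (h : ∀ q, z ∈ filt R M q) : z = 0 :=
  completedTensor_ext R fun m => by rw [h (m + 1) m m.lt_succ_self, map_zero]

theorem comp_eq_of_sub_mem_filt {q m : ℕ} {a b : CompletedTensor R M} (h : a - b ∈ filt R M q)
    (hm : m < q) : comp R m a = comp R m b := by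
  have := h m hm
  rwa [map_sub, sub_eq_zero] at this

theorem incl_mem_filt_one (x : M) : incl R x ∈ filt R M 1 := by
  intro m hm
  obtain rfl : m = 0 := by omega
  refine Subtype.ext ?_
  rw [coe_comp_incl, if_neg zero_ne_one]
  rfl

/-! ### Density of the tensor algebra in its completion -/

variable (R M) in
/-- The inclusion of the tensor algebra in its completion. -/
def ofTensor : TensorAlgebra R M →ₐ[R] CompletedTensor R M :=
  TensorAlgebra.lift R (incl R)

@[simp]
theorem ofTensor_ι (x : M) : ofTensor R M (TensorAlgebra.ι R x) = incl R x := by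
  rw [ofTensor, TensorAlgebra.lift_ι_apply]

theorem coe_incl (x : M) :
    (incl R x : CompletedTensor R M).1 = PowerSeries.monomial 1 (TensorAlgebra.ι R x) := by
  ext m
  rw [← coe_comp, coe_comp_incl, PowerSeries.coeff_monomial]

theorem coe_ofTensor {k : ℕ} {a : TensorAlgebra R M} (ha : a ∈ tensorPow R M k) :
    (ofTensor R M a).1 = PowerSeries.monomial k a := by
  induction ha using Submodule.pow_induction_on_left' with
  | algebraMap r =>
    rw [AlgHom.commutes, PowerSeries.monomial_zero_eq_C_apply, ← PowerSeries.algebraMap_apply]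
    rfl
  | add x y i hx hy hx' hy' =>
    rw [map_add, map_add, ← hx', ← hy']
    rfl
  | mem_mul m hm i x hx ih =>
    obtain ⟨m, rfl⟩ := hm
    rw [map_mul, ofTensor_ι, Nat.succ_eq_one_add, ← PowerSeries.monomial_mul_monomial, ← ih,
      ← coe_incl]
    rfl

theorem coe_comp_ofTensor {k : ℕ} {a : TensorAlgebra R M} (ha : a ∈ tensorPow R M k) (m : ℕ) :
    (comp R m (ofTensor R M a) : TensorAlgebra R M) = if m = k then a else 0 := by
  rw [coe_comp, coe_ofTensor ha, PowerSeries.coeff_monomial]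

variable (R M) in
/-- The sum of the components of degree less than `q`. -/
def trunc (q : ℕ) : CompletedTensor R M →ₗ[R] TensorAlgebra R M :=
  ∑ k ∈ Finset.range q, (tensorPow R M k).subtype ∘ₗ comp R k

theorem trunc_apply (q : ℕ) (z : CompletedTensor R M) :
    trunc R M q z = ∑ k ∈ Finset.range q, (comp R k z : TensorAlgebra R M) := by
  simp [trunc]

theorem sub_ofTensor_trunc_mem_filt (q : ℕ) (z : CompletedTensor R M) :
    z - ofTensor R M (trunc R M q z) ∈ filt R M q := by
  intro m hm
  refine Subtype.ext ?_
  rw [trunc_apply, map_sub, map_sum, map_sum, Submodule.coe_sub, Submodule.coe_sum]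
  simp_rw [coe_comp_ofTensor (comp R _ z).2]
  rw [Finset.sum_ite_eq, if_pos (Finset.mem_range.mpr hm), sub_self]
  rfl

/-- A tensor has finitely many homogeneous components. This lets `a` be recovered from its image in
the completion. -/
theorem exists_trunc_ofTensor (a : TensorAlgebra R M) :
    ∃ N, ∀ q, N ≤ q → trunc R M q (ofTensor R M a) = a := by
  induction a using DirectSum.Decomposition.inductionOn (tensorPow R M) with
  | zero => exact ⟨0, fun q _ => by rw [map_zero, map_zero]⟩
  | @homogeneous i a =>
    refine ⟨i + 1, fun q hq => ?_⟩
    rw [trunc_apply]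
    simp_rw [coe_comp_ofTensor a.2]
    rw [Finset.sum_ite_eq', if_pos (Finset.mem_range.mpr hq)]
  | add a b ha hb =>
    obtain ⟨N, hN⟩ := ha
    obtain ⟨N', hN'⟩ := hb
    refine ⟨max N N', fun q hq => ?_⟩
    rw [map_add, map_add, hN q (le_of_max_le_left hq), hN' q (le_of_max_le_right hq)]

/-! ### Continuous extension of a linear map -/

section Lift

variable (f : M →ₗ[R] CompletedTensor R M)

theorem lift_mem_filt (hf : ∀ x, f x ∈ filt R M 1)
    {k : ℕ} {a : TensorAlgebra R M} (ha : a ∈ tensorPow R M k) :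
    TensorAlgebra.lift R f a ∈ filt R M k := by
  induction ha using Submodule.pow_induction_on_left' with
  | algebraMap r => exact mem_filt_zero _
  | add x y i hx hy hx' hy' =>
    rw [map_add]
    exact Submodule.add_mem _ hx' hy'
  | mem_mul m hm i x hx ih =>
    obtain ⟨m, rfl⟩ := hm
    rw [map_mul, TensorAlgebra.lift_ι_apply, Nat.succ_eq_one_add]
    exact mul_mem_filt (hf m) ih

/-- Continuity of the lift for the topology induced from the completion: the components of `a` below
degree `q` vanish, and the others are sent into `filt q`. -/
theorem lift_mem_filt_of_ofTensor_mem_filt (hf : ∀ x, f x ∈ filt R M 1)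
    {q : ℕ} {a : TensorAlgebra R M}
    (ha : ofTensor R M a ∈ filt R M q) : TensorAlgebra.lift R f a ∈ filt R M q := by
  obtain ⟨N, hN⟩ := exists_trunc_ofTensor a
  rw [← hN N le_rfl, trunc_apply, map_sum]
  refine Submodule.sum_mem _ fun k _ => ?_
  rcases lt_or_ge k q with h | h
  · rw [ha k h, Submodule.coe_zero, map_zero]
    exact Submodule.zero_mem _
  · exact filt_anti h (lift_mem_filt f hf (comp R k _).2)

/-- The values of the continuous extension of `f` to the completed tensor algebra. -/
def extendFun (z : CompletedTensor R M) : CompletedTensor R M :=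
  -- Truncation below degree `m + 1` suffices for component `m`, since the lift of a map into `filt
  -- 1` never lowers degrees.
  ofSeq fun m => comp R m (TensorAlgebra.lift R f (trunc R M (m + 1) z))

/-- Any approximation `a` of `z` serves, not only the truncation. Sums and products of truncations,
which need not be truncations, can therefore be used to check that `extendFun` is an algebra map. -/
theorem extendFun_sub_mem_filt (hf : ∀ x, f x ∈ filt R M 1)
    {q : ℕ} {z : CompletedTensor R M} {a : TensorAlgebra R M}
    (h : z - ofTensor R M a ∈ filt R M q) :
    extendFun f z - TensorAlgebra.lift R f a ∈ filt R M q := by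
  intro m hm
  rw [map_sub, extendFun, comp_ofSeq, ← map_sub, ← map_sub]
  refine lift_mem_filt_of_ofTensor_mem_filt f hf ?_ m m.lt_succ_self
  have h1 := Submodule.sub_mem _ (filt_anti (Nat.succ_le_of_lt hm) h)
    (sub_ofTensor_trunc_mem_filt (m + 1) z)
  rwa [sub_sub_sub_cancel_left, ← map_sub] at h1

theorem extendFun_eq (hf : ∀ x, f x ∈ filt R M 1) {z w : CompletedTensor R M}
    (h : ∀ q, ∃ a, z - ofTensor R M a ∈ filt R M q ∧ w - TensorAlgebra.lift R f a ∈ filt R M q) :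
    extendFun f z = w := by
  refine sub_eq_zero.mp (eq_zero_of_forall_mem_filt fun q => ?_)
  obtain ⟨a, ha, hw⟩ := h q
  have := Submodule.sub_mem _ (extendFun_sub_mem_filt f hf ha) hw
  rwa [sub_sub_sub_cancel_right] at this

theorem extendFun_sub_trunc_mem_filt (hf : ∀ x, f x ∈ filt R M 1)
    (q : ℕ) (z : CompletedTensor R M) :
    extendFun f z - TensorAlgebra.lift R f (trunc R M q z) ∈ filt R M q :=
  extendFun_sub_mem_filt f hf (sub_ofTensor_trunc_mem_filt q z)

theorem mul_sub_mul_mem_filt {q : ℕ} {a b c d : CompletedTensor R M} (h : a - c ∈ filt R M q)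
    (h' : b - d ∈ filt R M q) : a * b - c * d ∈ filt R M q := by
  have e : a * b - c * d = (a - c) * b + c * (b - d) := by
    rw [sub_mul, mul_sub]
    abel
  rw [e]
  exact Submodule.add_mem _ (mul_mem_filt_right h b) (mul_mem_filt_left c h')

/-- The continuous algebra endomorphism of the completed tensor algebra that extends a linear map
from `M` to `filt 1`. -/
def extend (hf : ∀ x, f x ∈ filt R M 1) : CompletedTensor R M →ₐ[R] CompletedTensor R M :=
  AlgHom.ofLinearMap
    { toFun := extendFun f
      map_add' := fun z w => extendFun_eq f hf fun q => ⟨trunc R M q z + trunc R M q w, by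
        rw [← map_add]
        exact sub_ofTensor_trunc_mem_filt q _, by
        rw [map_add, add_sub_add_comm]
        exact Submodule.add_mem _ (extendFun_sub_trunc_mem_filt f hf q z)
          (extendFun_sub_trunc_mem_filt f hf q w)⟩
      map_smul' := fun r z => extendFun_eq f hf fun q => ⟨r • trunc R M q z, by
        rw [← map_smul]
        exact sub_ofTensor_trunc_mem_filt q _, by
        rw [map_smul, RingHom.id_apply, ← smul_sub]
        exact Submodule.smul_mem _ r (extendFun_sub_trunc_mem_filt f hf q z)⟩ }
    (extendFun_eq f hf fun q => ⟨1, by simp, by simp⟩)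
    (fun z w => extendFun_eq f hf fun q => ⟨trunc R M q z * trunc R M q w, by
      rw [map_mul]
      exact mul_sub_mul_mem_filt (sub_ofTensor_trunc_mem_filt q z)
        (sub_ofTensor_trunc_mem_filt q w), by
      rw [map_mul]
      exact mul_sub_mul_mem_filt (extendFun_sub_trunc_mem_filt f hf q z)
        (extendFun_sub_trunc_mem_filt f hf q w)⟩)

theorem extend_incl (hf : ∀ x, f x ∈ filt R M 1) (x : M) : extend f hf (incl R x) = f x :=
  extendFun_eq f hf fun q => ⟨TensorAlgebra.ι R x, by simp, by simp⟩

theorem extend_mem_filt (hf : ∀ x, f x ∈ filt R M 1)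
    {q : ℕ} {z : CompletedTensor R M} (hz : z ∈ filt R M q) :
    extend f hf z ∈ filt R M q := by
  have h := extendFun_sub_mem_filt f hf (z := z) (a := 0) (q := q) (by simpa using hz)
  rwa [map_zero, sub_zero] at h

end Lift

/-! ### Filtered endomorphisms close to the identity -/

theorem algHom_ext_of_incl {F G : CompletedTensor R M →ₐ[R] CompletedTensor R M}
    (hF : ∀ q, ∀ z ∈ filt R M q, F z ∈ filt R M q) (hG : ∀ q, ∀ z ∈ filt R M q, G z ∈ filt R M q)
    (h : ∀ x, F (incl R x) = G (incl R x)) : F = G := by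
  have key : F.comp (ofTensor R M) = G.comp (ofTensor R M) := by
    ext x
    simp [h]
  ext1 z
  -- `F` and `G` agree on the truncation of `z` and keep the remainder in `filt q`, for every `q`.
  refine sub_eq_zero.mp (eq_zero_of_forall_mem_filt fun q => ?_)
  have hz := sub_ofTensor_trunc_mem_filt q z
  have h1 := Submodule.sub_mem _ (hF q _ hz) (hG q _ hz)
  have e := DFunLike.congr_fun key (trunc R M q z)
  rw [AlgHom.comp_apply, AlgHom.comp_apply] at e
  rwa [map_sub, map_sub, e, sub_sub_sub_cancel_right] at h1

/-- If an endomorphism is the identity on `M` up to terms raising the degree by `k`, so is it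
everywhere. -/
theorem sub_mem_filt_add {F : CompletedTensor R M →ₐ[R] CompletedTensor R M}
    (hF : ∀ q, ∀ z ∈ filt R M q, F z ∈ filt R M q) {k : ℕ}
    (h : ∀ x, F (incl R x) - incl R x ∈ filt R M (k + 1)) {p : ℕ} {z : CompletedTensor R M}
    (hz : z ∈ filt R M p) : F z - z ∈ filt R M (p + k) := by
  have hom : ∀ {i : ℕ} {a : TensorAlgebra R M}, a ∈ tensorPow R M i →
      F (ofTensor R M a) - ofTensor R M a ∈ filt R M (i + k) := by
    intro i a ha
    induction ha using Submodule.pow_induction_on_left' with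
    | algebraMap r =>
      rw [AlgHom.commutes, AlgHom.commutes, sub_self]
      exact Submodule.zero_mem _
    | add x y i hx hy hx' hy' =>
      rw [map_add, map_add, add_sub_add_comm]
      exact Submodule.add_mem _ hx' hy'
    | mem_mul m hm i x hx ih =>
      obtain ⟨m, rfl⟩ := hm
      -- A twisted Leibniz rule: each summand contains one difference, which gains `k` degrees.
      have e : F (ofTensor R M (TensorAlgebra.ι R m * x)) - ofTensor R M (TensorAlgebra.ι R m * x) =
          F (incl R m) * (F (ofTensor R M x) - ofTensor R M x) +
            (F (incl R m) - incl R m) * ofTensor R M x := by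
        rw [map_mul, map_mul, ofTensor_ι, mul_sub, sub_mul]
        abel
      have hx1 : ofTensor R M x ∈ filt R M i := by
        intro j hj
        refine Subtype.ext ?_
        rw [coe_comp_ofTensor hx, if_neg hj.ne]
        rfl
      rw [e]
      refine Submodule.add_mem _ (filt_anti (by omega)
        (mul_mem_filt (hF 1 _ (incl_mem_filt_one m)) ih))
        (filt_anti (by omega) (mul_mem_filt (h m) hx1))
  -- The remainder and its image already lie in `filt (p + k)`, so only finitely many homogeneous
  -- components of `z` matter.
  have hr := sub_ofTensor_trunc_mem_filt (p + k) z
  have h1 := Submodule.sub_mem _ (hF _ _ hr) hr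
  have h2 : F (ofTensor R M (trunc R M (p + k) z)) - ofTensor R M (trunc R M (p + k) z) ∈
      filt R M (p + k) := by
    rw [trunc_apply, map_sum, map_sum, ← Finset.sum_sub_distrib]
    refine Submodule.sum_mem _ fun j _ => ?_
    rcases lt_or_ge j p with hj | hj
    · rw [hz j hj, Submodule.coe_zero, map_zero, map_zero, sub_zero]
      exact Submodule.zero_mem _
    · exact filt_anti (by omega) (hom (comp R j z).2)
  have h3 := Submodule.add_mem _ h1 h2
  rw [map_sub] at h3
  convert h3 using 1
  abel

/-- A linear endomorphism that is congruent to the identity on the associated graded module is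
bijective: its inverse is given by a Neumann series. -/
theorem bijective_of_sub_mem_filt {F : CompletedTensor R M →ₗ[R] CompletedTensor R M}
    (h : ∀ p, ∀ z ∈ filt R M p, F z - z ∈ filt R M (p + 1)) : Function.Bijective F := by
  constructor
  · rw [← LinearMap.ker_eq_bot, LinearMap.ker_eq_bot']
    intro z hz
    refine eq_zero_of_forall_mem_filt fun q => ?_
    induction q with
    | zero => exact mem_filt_zero z
    | succ q ih =>
      have := h q z ih
      rwa [hz, zero_sub, Submodule.neg_mem_iff] at this
  · intro w
    -- Partial sums of the Neumann series, built by adding the current error `w - F (S q)`; each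
    -- step pushes the error one degree further.
    let S : ℕ → CompletedTensor R M := fun q => Nat.rec 0 (fun _ s => s + (w - F s)) q
    have hS : ∀ q, w - F (S q) ∈ filt R M q := by
      intro q
      induction q with
      | zero => exact mem_filt_zero _
      | succ q ih =>
        have := Submodule.neg_mem _ (h q _ ih)
        have e : w - F (S (q + 1)) = -(F (w - F (S q)) - (w - F (S q))) := by
          change w - F (S q + (w - F (S q))) = _
          rw [map_add]
          abel
        rwa [e]
    have hS' : ∀ p q, p ≤ q → S q - S p ∈ filt R M p := by
      intro p q hpq
      induction q, hpq using Nat.le_induction with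
      | base =>
        rw [sub_self]
        exact Submodule.zero_mem _
      | succ q hq ih =>
        have e : S (q + 1) - S p = (w - F (S q)) + (S q - S p) := by
          change S q + (w - F (S q)) - S p = _
          abel
        rw [e]
        exact Submodule.add_mem _ (filt_anti hq (hS q)) ih
    -- The limit: component `m` of `S q` is constant for `q ≥ m + 1`.
    let z : CompletedTensor R M := ofSeq fun m => comp R m (S (m + 1))
    have hz : ∀ q, z - S q ∈ filt R M q := by
      intro q m hm
      rw [map_sub, comp_ofSeq, sub_eq_zero]
      exact (comp_eq_of_sub_mem_filt (hS' (m + 1) q hm) m.lt_succ_self).symm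
    refine ⟨z, sub_eq_zero.mp (eq_zero_of_forall_mem_filt fun q => ?_)⟩
    have h1 := Submodule.add_mem _ (filt_anti (Nat.le_succ q) (h q _ (hz q))) (hz q)
    rw [sub_add_cancel, map_sub] at h1
    have h2 := Submodule.sub_mem _ h1 (hS q)
    rwa [sub_sub_sub_cancel_right] at h2

/-- `z` and `F z` have the same leading term. This gives the inclusion of `filt p` in its image that
membership in `IA` demands. -/
theorem mem_filt_of_sub_mem_filt {F : CompletedTensor R M →ₗ[R] CompletedTensor R M}
    (h : ∀ p, ∀ z ∈ filt R M p, F z - z ∈ filt R M (p + 1)) {p : ℕ} {z : CompletedTensor R M}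
    (hz : F z ∈ filt R M p) : z ∈ filt R M p := by
  have key : ∀ q ≤ p, z ∈ filt R M q := by
    intro q
    induction q with
    | zero => exact fun _ => mem_filt_zero z
    | succ q ih =>
      intro hq
      have := Submodule.sub_mem _ (filt_anti hq hz) (h q z (ih (by omega)))
      rwa [sub_sub_cancel] at this
  exact key p le_rfl

/-- A linear map from `M` to the completed tensor algebra congruent to the inclusion modulo
`filt 2` extends to an element of `IA`. -/
theorem exists_mem_IA_incl (f : M →ₗ[R] CompletedTensor R M)
    (hf : ∀ x, f x - incl R x ∈ filt R M 2) : ∃ U ∈ IA R M, ∀ x, U (incl R x) = f x := by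
  have hf1 : ∀ x, f x ∈ filt R M 1 := fun x => by
    have := Submodule.add_mem _ (filt_anti one_le_two (hf x)) (incl_mem_filt_one x)
    rwa [sub_add_cancel] at this
  have h : ∀ p, ∀ z ∈ filt R M p, (extend f hf1).toLinearMap z - z ∈ filt R M (p + 1) :=
    fun p z hz => sub_mem_filt_add (fun q z hz => extend_mem_filt f hf1 hz)
      (fun x => by rw [extend_incl]; exact hf x) hz
  have hb := bijective_of_sub_mem_filt h
  refine ⟨AlgEquiv.ofBijective (extend f hf1) hb, ⟨fun p _ => le_antisymm ?_ ?_, h 1⟩,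
    extend_incl f hf1⟩
  · rintro _ ⟨z, hz, rfl⟩
    exact extend_mem_filt f hf1 hz
  · intro w hw
    obtain ⟨z, rfl⟩ := hb.2 w
    exact ⟨z, mem_filt_of_sub_mem_filt h hw, rfl⟩

theorem mem_filt_of_mem_IA {U : CompletedTensor R M ≃ₐ[R] CompletedTensor R M} (hU : U ∈ IA R M)
    (q : ℕ) (z : CompletedTensor R M) (hz : z ∈ filt R M q) : U z ∈ filt R M q := by
  rcases Nat.eq_zero_or_pos q with rfl | hq
  · exact mem_filt_zero _
  · rw [← hU.1 q hq]
    exact ⟨z, hz, rfl⟩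

theorem sub_mem_filt_of_mem_IA {U : CompletedTensor R M ≃ₐ[R] CompletedTensor R M}
    (hU : U ∈ IA R M) {k : ℕ} (h : ∀ x, U (incl R x) - incl R x ∈ filt R M (k + 1)) {p : ℕ}
    {z : CompletedTensor R M} (hz : z ∈ filt R M p) : U z - z ∈ filt R M (p + k) :=
  sub_mem_filt_add (F := U.toAlgHom) (mem_filt_of_mem_IA hU) h hz

theorem incl_sub_mem_filt_of_mem_IA {U : CompletedTensor R M ≃ₐ[R] CompletedTensor R M}
    (hU : U ∈ IA R M) (x : M) : U (incl R x) - incl R x ∈ filt R M 2 :=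
  hU.2 _ (incl_mem_filt_one x)

theorem eq_of_incl_eq_of_mem_IA {U V : CompletedTensor R M ≃ₐ[R] CompletedTensor R M}
    (hU : U ∈ IA R M) (hV : V ∈ IA R M) (h : ∀ x, U (incl R x) = V (incl R x)) : U = V :=
  AlgEquiv.coe_toAlgHom_injective (algHom_ext_of_incl (F := U.toAlgHom) (G := V.toAlgHom)
    (mem_filt_of_mem_IA hU) (mem_filt_of_mem_IA hV) h)

end Endomorphisms
/-! ### Comparison of Magnus expansions -/

section Comparison

variable {R : Type*} [CommRing R] {n : ℕ}

/-- Composed with `cls`, a linear map on `H R n` becomes a homomorphism from the free group, so the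
generators determine it. With `exists_linearMap_cls_of`, this says that their classes form a basis.
-/
theorem linearMap_ext_of {N : Type*} [AddCommGroup N] [Module R N] {f g : H R n →ₗ[R] N}
    (h : ∀ i, f (cls R (FreeGroup.of i)) = g (cls R (FreeGroup.of i))) : f = g := by
  have key : ∀ γ : FreeGroup (Fin n), f (cls R γ) = g (cls R γ) := by
    let F (k : H R n →ₗ[R] N) : FreeGroup (Fin n) →* Multiplicative N :=
      { toFun := fun γ => Multiplicative.ofAdd (k (cls R γ))
        map_one' := by
          have h0 : cls R (1 : FreeGroup (Fin n)) = 0 := by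
            rw [cls, map_one, ofMul_one, TensorProduct.tmul_zero]
          rw [h0, map_zero, ofAdd_zero]
        map_mul' := fun a b => by rw [cls_mul, map_add, ofAdd_add] }
    have hF : F f = F g := FreeGroup.ext_hom _ _ fun i => congrArg Multiplicative.ofAdd (h i)
    exact fun γ => Multiplicative.ofAdd.injective (DFunLike.congr_fun hF γ)
  ext1
  refine LinearMap.ext_ring (LinearMap.ext fun a => ?_)
  induction a using Additive.rec with | _ a =>
  induction a using QuotientGroup.induction_on with | H γ => exact key γ

theorem linearMap_ext_cls {N : Type*} [AddCommGroup N] [Module R N] {f g : H R n →ₗ[R] N}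
    (h : ∀ γ, f (cls R γ) = g (cls R γ)) : f = g :=
  linearMap_ext_of fun _ => h _

theorem exists_linearMap_cls_of {N : Type*} [AddCommGroup N] [Module R N] (v : Fin n → N) :
    ∃ f : H R n →ₗ[R] N, ∀ i, f (cls R (FreeGroup.of i)) = v i := by
  refine ⟨LinearMap.liftBaseChange R (AddMonoidHom.toIntLinearMap (MonoidHom.toAdditiveLeft
    (Abelianization.lift (FreeGroup.lift fun i => Multiplicative.ofAdd (v i))))), fun i => ?_⟩
  rw [cls, LinearMap.liftBaseChange_tmul, one_smul]
  change Multiplicative.toAdd (Abelianization.lift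
    (FreeGroup.lift fun i => Multiplicative.ofAdd (v i)) (Abelianization.of (FreeGroup.of i))) = v i
  rw [Abelianization.lift_apply_of, FreeGroup.lift_apply_of]
  rfl

/-! ### The action of `IA` on Magnus expansions -/

namespace MagnusExpansion

theorem exists_mem_IA_incl_eq (θ : MagnusExpansion R n) :
    ∃ V ∈ IA R (H R n), ∀ i, V (incl R (cls R (FreeGroup.of i))) =
      θ.toHom (FreeGroup.of i) - 1 := by
  obtain ⟨f, hf⟩ := exists_linearMap_cls_of (R := R) fun i => θ.toHom (FreeGroup.of i) - 1
  -- Congruence modulo `filt 2` is an equality of linear maps to the quotient, so generators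
  -- suffice.
  have hf2 : (filt R (H R n) 2).mkQ ∘ₗ f = (filt R (H R n) 2).mkQ ∘ₗ incl R := by
    refine linearMap_ext_of fun i => ?_
    refine (Submodule.Quotient.eq _).mpr ?_
    rw [hf, sub_sub]
    exact θ.congr_one_add _
  obtain ⟨V, hV, hVf⟩ := exists_mem_IA_incl f fun x =>
    (Submodule.Quotient.eq _).mp (DFunLike.congr_fun hf2 x)
  exact ⟨V, hV, fun i => by rw [hVf, hf]⟩

/-- Any two Magnus expansions differ by an element of `IA`. -/
theorem exists_mem_IA_apply_eq (θ θ' : MagnusExpansion R n) :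
    ∃ W ∈ IA R (H R n), ∀ γ, θ'.toHom γ = W (θ.toHom γ) := by
  obtain ⟨V, hV, hVθ⟩ := θ.exists_mem_IA_incl_eq
  obtain ⟨V', hV', hVθ'⟩ := θ'.exists_mem_IA_incl_eq
  -- Go from `θ` back to the standard expansion by `V⁻¹`, then on to `θ'` by `V'`.
  refine ⟨V' * V⁻¹, Subgroup.mul_mem _ hV' (Subgroup.inv_mem _ hV), fun γ => ?_⟩
  have h : θ'.toHom = (V' * V⁻¹).toRingEquiv.toRingHom.toMonoidHom.comp θ.toHom := by
    refine FreeGroup.ext_hom _ _ fun i => ?_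
    have e : θ.toHom (FreeGroup.of i) = V (incl R (cls R (FreeGroup.of i))) + 1 := by
      rw [hVθ, sub_add_cancel]
    have e' : θ'.toHom (FreeGroup.of i) = V' (incl R (cls R (FreeGroup.of i))) + 1 := by
      rw [hVθ', sub_add_cancel]
    have e2 : V⁻¹ (V (incl R (cls R (FreeGroup.of i)))) = incl R (cls R (FreeGroup.of i)) :=
      V.symm_apply_apply _
    change _ = V' (V⁻¹ (θ.toHom (FreeGroup.of i)))
    rw [e, e', map_add, map_add, map_one, map_one, e2]
  exact DFunLike.congr_fun h γ

/-- The group `IA` acts freely on Magnus expansions. -/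
theorem eq_of_apply_eq (θ : MagnusExpansion R n)
    {U U' : CompletedTensor R (H R n) ≃ₐ[R] CompletedTensor R (H R n)}
    (hU : U ∈ IA R (H R n)) (hU' : U' ∈ IA R (H R n))
    (h : ∀ γ, U (θ.toHom γ) = U' (θ.toHom γ)) : U = U' := by
  obtain ⟨V, hV, hVθ⟩ := θ.exists_mem_IA_incl_eq
  -- After composition with `V`, the values on the basis are those at `θ(x_i) - 1`, where the
  -- hypothesis applies.
  refine mul_right_cancel (b := V) (eq_of_incl_eq_of_mem_IA (Subgroup.mul_mem _ hU hV)
    (Subgroup.mul_mem _ hU' hV) fun x => ?_)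
  have hlin : (U * V).toLinearMap ∘ₗ incl R = (U' * V).toLinearMap ∘ₗ incl R := by
    refine linearMap_ext_of fun i => ?_
    change U (V (incl R (cls R (FreeGroup.of i)))) = U' (V (incl R (cls R (FreeGroup.of i))))
    rw [hVθ, map_sub, map_sub, h, map_one, map_one]
  exact DFunLike.congr_fun hlin x

theorem existsUnique_totalJohnson (θ : MagnusExpansion R n) (φ : MulAut (FreeGroup (Fin n))) :
    ∃! U : CompletedTensor R (H R n) ≃ₐ[R] CompletedTensor R (H R n),
      U ∈ IA R (H R n) ∧ ∀ γ, (θ.act φ).toHom γ = U⁻¹ (θ.toHom γ) := by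
  obtain ⟨W, hW, h⟩ := θ.exists_mem_IA_apply_eq (θ.act φ)
  refine ⟨W⁻¹, ⟨Subgroup.inv_mem _ hW, fun γ => by rw [inv_inv, h]⟩, ?_⟩
  rintro U ⟨hU, hUθ⟩
  refine inv_injective (θ.eq_of_apply_eq (Subgroup.inv_mem _ hU)
    (Subgroup.inv_mem _ (Subgroup.inv_mem _ hW)) fun γ => ?_)
  rw [← hUθ, inv_inv, h]

theorem totalJohnson_spec (θ : MagnusExpansion R n) (φ : MulAut (FreeGroup (Fin n))) :
    θ.totalJohnson φ ∈ IA R (H R n) ∧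
      ∀ γ, (θ.act φ).toHom γ = (θ.totalJohnson φ)⁻¹ (θ.toHom γ) := by
  have h : ∃ U ∈ IA R (H R n), ∀ γ, (θ.act φ).toHom γ = U⁻¹ (θ.toHom γ) :=
    (θ.existsUnique_totalJohnson φ).exists
  rw [totalJohnson, dif_pos h]
  exact h.choose_spec

/-- Elements of `IA` move `filt (m+1)` only by `filt (m+2)`, and `θ(γ) - 1` lies in the former: its
leading term is fixed. -/
theorem apply_sub_mem_filt (θ : MagnusExpansion R n) {m : ℕ} {γ : FreeGroup (Fin n)}
    (hγ : γ ∈ Gam n m) {U : CompletedTensor R (H R n) ≃ₐ[R] CompletedTensor R (H R n)}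
    (hU : U ∈ IA R (H R n)) : U (θ.toHom γ) - θ.toHom γ ∈ filt R (H R n) (m + 2) := by
  have h := sub_mem_filt_of_mem_IA hU (k := 1) (incl_sub_mem_filt_of_mem_IA hU)
    (θ.sub_one_mem_of_mem_Gam m γ hγ)
  rwa [map_sub, map_one, sub_sub_sub_cancel_right] at h

/-- The component of degree `m + 1` of a Magnus expansion on `Γ_{m+1}` does not depend on the
expansion. -/
theorem comp_eq_of_mem_Gam (θ θ' : MagnusExpansion R n) {m : ℕ} {γ : FreeGroup (Fin n)}
    (hγ : γ ∈ Gam n m) : comp R (m + 1) (θ'.toHom γ) = comp R (m + 1) (θ.toHom γ) := by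
  obtain ⟨W, hW, h⟩ := θ.exists_mem_IA_apply_eq θ'
  rw [h]
  exact comp_eq_of_sub_mem_filt (θ.apply_sub_mem_filt hγ hW) (by omega)

end MagnusExpansion

/-! ### Johnson maps on the Andreadakis filtration -/

theorem absMap_eq_id {m : ℕ} (hm : 1 ≤ m) (φ : Andreadakis n m) :
    absMap R φ.1 = LinearMap.id := by
  refine linearMap_ext_cls fun γ => ?_
  -- `Gam n 1` is the commutator subgroup, which is why `m ≥ 1` is needed.
  have h : γ⁻¹ * φ.1 γ ∈ commutator (FreeGroup (Fin n)) :=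
    Subgroup.lowerCentralSeries_antitone ⊤ hm (inv_mul_mem_Gam φ γ)
  have e : Abelianization.of (φ.1 γ) = Abelianization.of γ := (QuotientGroup.eq.mpr h).symm
  rw [absMap_cls, cls, e]
  rfl

theorem mapCompleted_id {M : Type*} [AddCommGroup M] [Module R M] (z : CompletedTensor R M) :
    mapCompleted R (LinearMap.id : M →ₗ[R] M) z = z := by
  have h : mapTensor (LinearMap.id : M →ₗ[R] M) = AlgHom.id R _ := by
    ext x
    rw [LinearMap.comp_apply, AlgHom.toLinearMap_apply, mapTensor_ι]
    rfl
  refine completedTensor_ext R fun m => Subtype.ext ?_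
  rw [comp_mapCompleted, h, AlgHom.id_apply]

namespace MagnusExpansion

theorem totalJohnson_apply (θ : MagnusExpansion R n) {m : ℕ} (hm : 1 ≤ m) (φ : Andreadakis n m)
    (γ : FreeGroup (Fin n)) : θ.totalJohnson φ.1 (θ.toHom γ) = θ.toHom (φ.1 γ) := by
  have h := (θ.totalJohnson_spec φ.1).2 (φ.1 γ)
  have e : (θ.act φ.1).toHom (φ.1 γ) = θ.toHom γ := by
    change mapCompleted R (absMap R φ.1) (θ.toHom (φ.1⁻¹ (φ.1 γ))) = _
    rw [absMap_eq_id hm, mapCompleted_id, MulAut.inv_apply_self]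
  rw [e] at h
  rw [h]
  exact (θ.totalJohnson φ.1).apply_symm_apply _

/-- If `U` moves `H` by `k` degrees, it moves the tail `θ(γ) - 1 - [γ]`, which starts in degree 2,
only by `filt (k+2)`. So `U [γ] - [γ]` may be replaced by `U θ(γ) - θ(γ) = θ(γ) (θ(c) - 1)` with `c
= γ⁻¹ φ(γ)`, and there the factor `θ(γ)` is 1 to this precision. -/
theorem totalJohnson_incl_sub_mem (θ : MagnusExpansion R n) {m : ℕ} (hm : 1 ≤ m)
    (φ : Andreadakis n m) (γ : FreeGroup (Fin n)) {k : ℕ}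
    (hk : ∀ x, θ.totalJohnson φ.1 (incl R x) - incl R x ∈ filt R (H R n) (k + 1)) (hkm : k ≤ m) :
    (θ.totalJohnson φ.1 (incl R (cls R γ)) - incl R (cls R γ)) -
      (θ.toHom (γ⁻¹ * φ.1 γ) - 1) ∈ filt R (H R n) (k + 2) := by
  set U := θ.totalJohnson φ.1 with hUdef
  have hU : U ∈ IA R (H R n) := (θ.totalJohnson_spec φ.1).1
  have h1 := sub_mem_filt_of_mem_IA hU hk (θ.congr_one_add γ)
  have hc := θ.sub_one_mem_of_mem_Gam m _ (inv_mul_mem_Gam φ γ)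
  have h2 := mul_mem_filt (θ.sub_one_mem γ) hc
  have e : θ.toHom (φ.1 γ) = θ.toHom γ * θ.toHom (γ⁻¹ * φ.1 γ) := by
    rw [← map_mul, mul_inv_cancel_left]
  have h3 := Submodule.sub_mem _ (filt_anti (by omega : k + 2 ≤ 1 + (m + 1)) h2)
    (filt_anti (by omega : k + 2 ≤ 2 + k) h1)
  convert h3 using 1
  rw [map_sub, map_add, map_one, θ.totalJohnson_apply hm, e]
  simp only [sub_mul, mul_sub, one_mul, mul_one]
  abel

/-- Bootstrap from membership in `IA` (`k = 1`): as long as `k < m`, the term `θ(c) - 1` of the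
previous estimate lies in `filt (k+2)`, so one more degree is gained. -/
theorem totalJohnson_incl_sub_incl_mem (θ : MagnusExpansion R n) {m : ℕ} (hm : 1 ≤ m)
    (φ : Andreadakis n m) (x : H R n) :
    θ.totalJohnson φ.1 (incl R x) - incl R x ∈ filt R (H R n) (m + 1) := by
  have key : ∀ k, 1 ≤ k → k ≤ m →
      ∀ x, θ.totalJohnson φ.1 (incl R x) - incl R x ∈ filt R (H R n) (k + 1) := by
    intro k hk
    induction k, hk using Nat.le_induction with
    | base => exact fun _ => incl_sub_mem_filt_of_mem_IA (θ.totalJohnson_spec φ.1).1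
    | succ k hk ih =>
      intro hkm
      -- The estimate is known on classes `[γ]` only; linearity modulo `filt (k + 2)` carries it to
      -- all of `H R n`.
      have hlin : (filt R (H R n) (k + 2)).mkQ ∘ₗ E R (θ.totalJohnson φ.1) = 0 := by
        refine linearMap_ext_cls fun γ => (Submodule.Quotient.mk_eq_zero _).mpr ?_
        have h := Submodule.add_mem _
          (θ.totalJohnson_incl_sub_mem hm φ γ (ih (by omega)) (by omega))
          (filt_anti (by omega) (θ.sub_one_mem_of_mem_Gam m _ (inv_mul_mem_Gam φ γ)))
        rwa [sub_add_cancel] at h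
      exact fun x => (Submodule.Quotient.mk_eq_zero _).mp (DFunLike.congr_fun hlin x)
  exact key m hm le_rfl x

theorem johnsonMap_cls (θ : MagnusExpansion R n) {m : ℕ} (hm : 1 ≤ m) (φ : Andreadakis n m)
    (γ : FreeGroup (Fin n)) :
    θ.johnsonMap m φ.1 (cls R γ) = comp R (m + 1) (θ.toHom (γ⁻¹ * φ.1 γ)) := by
  have h := comp_eq_of_sub_mem_filt (θ.totalJohnson_incl_sub_mem hm φ γ
    (θ.totalJohnson_incl_sub_incl_mem hm φ) le_rfl) (by omega : m + 1 < m + 2)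
  have h1 : comp R (m + 1) (1 : CompletedTensor R (H R n)) = 0 := by
    refine Subtype.ext ?_
    change PowerSeries.coeff (m + 1) (1 : PowerSeries (TensorAlgebra R (H R n))) = 0
    rw [PowerSeries.coeff_one, if_neg (Nat.succ_ne_zero m)]
  rw [map_sub _ (θ.toHom _), h1, sub_zero] at h
  exact h

theorem extendScalars_johnsonHom_cls (θ₀ : MagnusExpansion R n) {m : ℕ} (φ : Andreadakis n m)
    (γ : FreeGroup (Fin n)) :
    extendScalars θ₀ m (johnsonHom θ₀ m φ) (cls R γ) =
      comp R (m + 1) (θ₀.toHom (γ⁻¹ * φ.1 γ)) := by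
  rw [extendScalars, cls, LinearMap.liftBaseChange_tmul, one_smul]
  rfl

theorem johnsonMap_eq_extendScalars (θ θ₀ : MagnusExpansion R n) {m : ℕ} (hm : 1 ≤ m)
    (φ : Andreadakis n m) : θ.johnsonMap m φ = extendScalars θ₀ m (johnsonHom θ₀ m φ) :=
  linearMap_ext_cls fun γ => by
    rw [johnsonMap_cls θ hm, extendScalars_johnsonHom_cls,
      θ₀.comp_eq_of_mem_Gam θ (inv_mul_mem_Gam φ γ)]

theorem johnsonMap_mul (θ : MagnusExpansion R n) {m : ℕ} (hm : 1 ≤ m) (φ ψ : Andreadakis n m) :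
    θ.johnsonMap m (φ * ψ : Andreadakis n m) = θ.johnsonMap m φ + θ.johnsonMap m ψ := by
  refine linearMap_ext_cls fun γ => ?_
  rw [LinearMap.add_apply, johnsonMap_cls θ hm, johnsonMap_cls θ hm, johnsonMap_cls θ hm]
  have hφ := inv_mul_mem_Gam φ γ
  have hψ := inv_mul_mem_Gam ψ γ
  have hU := θ.apply_sub_mem_filt hψ (θ.totalJohnson_spec φ.1).1
  rw [θ.totalJohnson_apply hm] at hU
  have hφψ : φ.1 (γ⁻¹ * ψ.1 γ) ∈ Gam n m := by
    have h := Subgroup.mul_mem _ hψ (inv_mul_mem_Gam φ (γ⁻¹ * ψ.1 γ))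
    rwa [mul_inv_cancel_left] at h
  -- A cocycle identity. The twist by `φ` in the second factor is harmless: `θ ∘ φ = U ∘ θ` with `U`
  -- in `IA`, which preserves the leading term.
  have e : γ⁻¹ * (φ * ψ).1 γ = (γ⁻¹ * φ.1 γ) * φ.1 (γ⁻¹ * ψ.1 γ) := by
    rw [map_mul, map_inv, mul_assoc, mul_inv_cancel_left]
    rfl
  rw [e, ← comp_eq_of_sub_mem_filt hU (by omega)]
  exact congrArg Multiplicative.toAdd ((θ.grAux m).map_mul ⟨_, hφ⟩ ⟨_, hφψ⟩)

end MagnusExpansion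
end Comparison
end JohnsonMaps
end

open JohnsonMaps in
theorem theorem3p1 (n : ℕ) (hn : 2 ≤ n) (R : Type*) [CommRing R]
    (hR : Function.Injective (Int.cast : ℤ → R)) :
    (∀ (θ : MagnusExpansion R n) (φ : MulAut (FreeGroup (Fin n))),
      ∃! U : CompletedTensor R (H R n) ≃ₐ[R] CompletedTensor R (H R n),
        U ∈ IA R (H R n) ∧ ∀ γ, (θ.act φ).toHom γ = U⁻¹ (θ.toHom γ)) ∧
    ∀ m : ℕ, 1 ≤ m →
      (∀ (θ θ₀ : MagnusExpansion R n) (φ : Andreadakis n m),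
        θ.johnsonMap m φ = extendScalars θ₀ m (johnsonHom θ₀ m φ)) ∧
      (∀ (θ : MagnusExpansion R n) (φ ψ : Andreadakis n m),
        θ.johnsonMap m (φ * ψ : Andreadakis n m) = θ.johnsonMap m φ + θ.johnsonMap m ψ) ∧
      (∀ (θ θ' : MagnusExpansion R n) (φ : Andreadakis n m),
        θ.johnsonMap m φ = θ'.johnsonMap m φ) := by
  refine ⟨fun θ φ => θ.existsUnique_totalJohnson φ, fun m hm =>
    ⟨fun θ θ₀ φ => θ.johnsonMap_eq_extendScalars θ₀ hm φ, fun θ φ ψ => θ.johnsonMap_mul hm φ ψ,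
      fun θ θ' φ => ?_⟩⟩
  rw [θ.johnsonMap_eq_extendScalars θ hm φ, θ'.johnsonMap_eq_extendScalars θ hm φ]
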